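/- Let $\mathfrak g$ be a finite-dimensional simple Lie algebra over $\mathbb C$ with Cartan subalgebra $\mathfrak h$, root set $\Delta\subset\mathfrak h^*$, simple roots $\alpha_i$ and simple coroots $\alpha_i^\vee$ ($i\in I$), Cartan matrix $C_{i,j}=\langle\alpha_i^\vee,\alpha_j\rangle$, fundamental weights $\omega_i$ (so $\langle \omega_i,\alpha_j^\vee\rangle=\delta_{i,j}$), weight lattice $P=\bigoplus_{i\in I}\mathbb Z\omega_i$, and Weyl group $W$ generated by the simple reflections $s_i$, with length function $l$. For $\lambda\in P$ let $[\lambda]$ denote the corresponding element of the group ring $\mathbb Z[P]$, with $[\lambda][\mu]=[\lambda+\mu]$, and let $\mathbb Z[(1-[-\alpha])^{-1}]_{\alpha\in\Delta}$ be the subring of the fraction field of $\mathbb Z[P]$ generated by the elements $(1-[-\alpha])^{-1}$ for all (positive and negative) roots $\alpha\in\Delta$. Then there is a unique family $(\chi_\lambda)$ of elements of $\mathbb Z[(1-[-\alpha])^{-1}]_{\alpha\in\Delta}$, indexed by the set of weights $\{w(\omega_i) : w\in W,\ i\in I\}$ (so that $\chi_{w(\omega_i)}$ depends only on the weight $w(\omega_i)$),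 such that $\chi_{\omega_i}=1$ for all $i\in I$ and $$\chi_{ws_i(\omega_i)}\,\chi_{w(\omega_i)}=(1-[-w(\alpha_i)])^{-1}\prod_{j\in I,\ j\neq i}\chi_{w(\omega_j)}^{-C_{i,j}}$$ for all $w\in W$ and $i\in I$ with $l(ws_i)=l(w)+1$. -/

import Mathlib

noncomputable section

namespace ExtQQ

open RootPairing

/-! Throughout, `P` is a (finite, crystallographic) root system in `M`, with coroots in `N`, and
`b` is a base; the index set `I` of the Dynkin diagram is `b.support`. -/

section General

variable {ι k M N : Type*} [Field k] [AddCommGroup M] [Module k M]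
  [AddCommGroup N] [Module k N] {P : RootPairing ι k M N} (b : P.Base)

/-- The entry `C_{i,j} = ⟨α_i^∨, α_j⟩` of the Cartan matrix, in the convention of Kac, so that
`α_i = ∑_j C_{j,i} ω_j`. (`RootPairing.Base.cartanMatrix` is the transpose.) -/
def cartan [P.IsCrystallographic] (i j : b.support) : ℤ :=
  P.pairingIn ℤ j i

/-- The simple reflection `s_i`, as an element of the Weyl group. -/
def simpleReflection (i : b.support) : P.weylGroup :=
  weylGroup.ofIdx P i

/-- The length `l(w)`: the least length of a word in the simple reflections with product `w`. -/
def length (w : P.weylGroup) : ℕ :=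
  sInf {n : ℕ | ∃ l : List b.support, l.length = n ∧ (l.map (simpleReflection b)).prod = w}

section Weights

variable [P.IsRootSystem]

/-- The fundamental weight `ω_i`: the basis of `M` dual to the basis of simple coroots. -/
def fundamentalWeight (i : b.support) : M :=
  P.toLinearMap.toPerfPair.symm (b.toCoweightBasis.coord i)

open Classical in
theorem fundamentalWeight_coroot (i j : b.support) :
    P.toLinearMap (fundamentalWeight b i) (P.coroot j) = if i = j then 1 else 0 := by
  have h : P.toLinearMap (fundamentalWeight b i) = b.toCoweightBasis.coord i :=
    P.toLinearMap.toPerfPair.apply_symm_apply _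
  rw [h, ← b.toCoweightBasis_apply j, Module.Basis.coord_apply, Module.Basis.repr_self,
    Finsupp.single_apply]
  simp [eq_comm]

/-- The weight lattice `P = ⨁_i ℤ ω_i`. -/
def weightLattice : AddSubgroup M :=
  AddSubgroup.closure (Set.range (fundamentalWeight b))

theorem mem_weightLattice_iff (x : M) :
    x ∈ weightLattice b ↔ ∀ i : b.support, ∃ n : ℤ, P.toLinearMap x (P.coroot i) = n := by
  classical
  constructor
  · intro hx
    induction hx using AddSubgroup.closure_induction with
    | mem x hx =>
      obtain ⟨j, rfl⟩ := hx
      intro i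
      exact ⟨if j = i then 1 else 0, by rw [fundamentalWeight_coroot]; split_ifs <;> simp⟩
    | zero => exact fun i => ⟨0, by simp⟩
    | add x y _ _ hx hy =>
      intro i
      obtain ⟨m, hm⟩ := hx i
      obtain ⟨n, hn⟩ := hy i
      exact ⟨m + n, by simp [hm, hn]⟩
    | neg x _ hx =>
      intro i
      obtain ⟨m, hm⟩ := hx i
      exact ⟨-m, by simp [hm]⟩
  · intro h
    choose n hn using h
    have hx : x = ∑ i, n i • fundamentalWeight b i := by
      apply P.toLinearMap.toPerfPair.injective
      apply b.toCoweightBasis.ext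
      intro j
      rw [b.toCoweightBasis_apply]
      change P.toLinearMap x _ = P.toLinearMap _ _
      simp [hn, LinearMap.sum_apply, fundamentalWeight_coroot]
    rw [hx]
    exact sum_mem fun i _ =>
      zsmul_mem (AddSubgroup.subset_closure (Set.mem_range_self i)) _

theorem fundamentalWeight_mem (i : b.support) : fundamentalWeight b i ∈ weightLattice b :=
  AddSubgroup.subset_closure (Set.mem_range_self i)

variable [P.IsCrystallographic]

theorem root_mem_weightLattice (r : ι) : P.root r ∈ weightLattice b := by
  rw [mem_weightLattice_iff]
  exact fun i => ⟨P.pairingIn ℤ r i, by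
    rw [P.root_coroot_eq_pairing, ← P.algebraMap_pairingIn ℤ]; simp⟩

theorem smul_mem_weightLattice (w : P.weylGroup) {x : M} (hx : x ∈ weightLattice b) :
    w • x ∈ weightLattice b := by
  obtain ⟨w, hw⟩ := w
  change w • x ∈ _
  induction hw using weylGroup.induction generalizing x with
  | mem r =>
    rw [Equiv.reflection_smul, P.reflection_apply]
    have hn : ∃ n : ℤ, P.coroot' r x = n := by
      have hr := b.coroot_mem_span_int r
      change ∃ n : ℤ, P.toLinearMap x (P.coroot r) = n
      generalize P.coroot r = y at hr
      induction hr using Submodule.span_induction with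
      | mem y hy =>
        obtain ⟨i, hi, rfl⟩ := hy
        exact (mem_weightLattice_iff b x).1 hx ⟨i, hi⟩
      | zero => exact ⟨0, by simp⟩
      | add y z _ _ hy hz =>
        obtain ⟨m, hm⟩ := hy
        obtain ⟨n, hn⟩ := hz
        exact ⟨m + n, by simp [hm, hn]⟩
      | smul c y _ hy =>
        obtain ⟨m, hm⟩ := hy
        exact ⟨c * m, by simp [hm]⟩
    obtain ⟨n, hn⟩ := hn
    rw [hn, Int.cast_smul_eq_zsmul]
    exact sub_mem hx (zsmul_mem (root_mem_weightLattice b r) n)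
  | one => simpa using hx
  | mul w₁ w₂ _ _ h₁ h₂ => rw [mul_smul]; exact h₁ (h₂ hx)


/-- The action of the Weyl group on the weight lattice. -/
instance : MulAction P.weylGroup (weightLattice b) where
  smul w x := ⟨w • (x : M), smul_mem_weightLattice b w x.2⟩
  one_smul x := Subtype.ext (one_smul _ (x : M))
  mul_smul v w x := Subtype.ext (mul_smul v w (x : M))

/-- The fundamental weight `ω_i` as an element of the weight lattice. -/
def omega (i : b.support) : weightLattice b :=
  ⟨fundamentalWeight b i, fundamentalWeight_mem b i⟩

/-- The root with index `r` as an element of the weight lattice. -/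
def rootWeight (r : ι) : weightLattice b :=
  ⟨P.root r, root_mem_weightLattice b r⟩

/-- The simple root `α_i` as an element of the weight lattice. -/
def alpha (i : b.support) : weightLattice b :=
  rootWeight b i

/-- The set of all weights `w(ω_i)` with `w ∈ W` and `i ∈ I`. -/
def extremalWeights : Set (weightLattice b) :=
  {x | ∃ (w : P.weylGroup) (i : b.support), x = w • omega b i}

/-- The weight `w(ω_i)` as an element of `extremalWeights`. -/
def extremal (w : P.weylGroup) (i : b.support) : extremalWeights b :=
  ⟨w • omega b i, w, i, rfl⟩

/-- The group ring `ℤ[P] = ℤ[y_i^{±1}]` of the weight lattice. -/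
abbrev WeightRing : Type _ :=
  AddMonoidAlgebra ℤ (weightLattice b)

instance [CharZero k] : TwoUniqueSums (weightLattice b) :=
  letI : Module ℚ M := Module.compHom M (algebraMap ℚ k)
  TwoUniqueSums.of_injective_addHom (weightLattice b).subtype.toAddHom
    Subtype.val_injective inferInstance

/-- The fraction field of `ℤ[P]`. -/
abbrev WeightField : Type _ :=
  FractionRing (WeightRing b)

/-- The element `[x]` of `ℤ[P]`, viewed in the fraction field. -/
def bracket (x : weightLattice b) : WeightField b :=
  algebraMap (WeightRing b) (WeightField b) (AddMonoidAlgebra.single x 1)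

/-- The ring `ℤ[(1 - [-α])⁻¹]_{α ∈ Δ}`, the subring of the fraction field of `ℤ[P]` generated by
the elements `(1 - [-α])⁻¹` for all roots `α`, positive and negative. -/
def chiRing [CharZero k] : Subring (WeightField b) :=
  Subring.closure (Set.range fun r : ι => (1 - bracket b (-rootWeight b r))⁻¹)

end Weights
end General
end ExtQQ

end

noncomputable section

namespace ExtQQ

open RootPairing

/-! ### Words in simple reflections, the exchange condition, signs of roots and coroots. -/

section WeylGroup

variable {ι k M N : Type*} [Field k] [AddCommGroup M] [Module k M]
  [AddCommGroup N] [Module k N] {P : RootPairing ι k M N} (b : P.Base)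

/-! The solution is explicit: `χ_{w(ω_i)} = ∏_{β>0} (1-[-β])^{-max(0,-⟨β,w(ω_i^∨)⟩)}`, where
`⟨β,w(ω_i^∨)⟩` is the coefficient of `α_i` in `w⁻¹β`.

Relation: `s_i(ω_i^∨) + ω_i^∨ = -∑_{j≠i} C_{i,j} ω_j^∨`, paired with `w⁻¹β`. Coefficients of a root
share one sign, and `s_i` preserves the sign of every root but `±α_i`, so truncation respects the
identity except when `w⁻¹β = ±α_i`. The length condition gives `wα_i > 0`, so only `β = wα_i`
occurs, and it yields the extra factor (`negCoeff_mul_simpleReflection_add`).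

Well-definedness: an element taking `ω_i` to `ω_j` takes `ω_i^∨` to `ω_j^∨`
(`repr_inv_smul_of_smul_fundamentalWeight_eq`).

Uniqueness: induction on length, dividing by nonzero values. -/

theorem root_weylGroup_smul (w : P.weylGroup) (r : ι) : P.root (w • r) = w • P.root r :=
  (weylGroup_apply_root P w r).symm

theorem ofIdx_smul_index (r t : ι) : weylGroup.ofIdx P r • t = P.reflectionPerm r t := rfl

theorem smul_coroot_invariant (w : P.weylGroup) (x : M) (r : ι) :
    P.toLinearMap (w • x) (P.coroot (w • r)) = P.toLinearMap x (P.coroot r) := by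
  obtain ⟨w, hw⟩ := w
  change P.toLinearMap (w • x) (P.coroot (w • r)) = _
  induction hw using weylGroup.induction generalizing x r with
  | mem t =>
    change P.coroot' (P.reflectionPerm t r) (P.reflection t x) = P.coroot' r x
    rw [← P.coroot'_reflection, reflection_same]
  | one => simp
  | mul w₁ w₂ _ _ h₁ h₂ => rw [mul_smul, mul_smul, h₁, h₂]

theorem weylGroup_ext {v w : P.weylGroup} (h : ∀ x : M, v • x = w • x) : v = w := by
  apply Subtype.ext
  apply RootPairing.Equiv.weightHom_injective P
  ext x
  exact h x

theorem conj_ofIdx (w : P.weylGroup) (r : ι) :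
    w * weylGroup.ofIdx P r = weylGroup.ofIdx P (w • r) * w := by
  apply weylGroup_ext
  intro x
  rw [mul_smul, mul_smul, weylGroup.ofIdx_smul, weylGroup.ofIdx_smul, Equiv.reflection_smul,
    Equiv.reflection_smul, reflection_apply, reflection_apply, smul_sub, root_weylGroup_smul,
    smul_comm w]
  congr 2
  exact (smul_coroot_invariant w x r).symm

theorem ofIdx_mul_self (r : ι) : weylGroup.ofIdx P r * weylGroup.ofIdx P r = 1 := by
  apply weylGroup_ext
  intro x
  simp [mul_smul]

theorem ofIdx_inv (r : ι) : (weylGroup.ofIdx P r)⁻¹ = weylGroup.ofIdx P r :=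
  inv_eq_of_mul_eq_one_left (ofIdx_mul_self r)

/-- The product of a word in the simple reflections. -/
def wordProd (l : List b.support) : P.weylGroup :=
  (l.map (simpleReflection b)).prod

@[simp] theorem wordProd_nil : wordProd b [] = 1 := rfl

@[simp] theorem wordProd_cons (i : b.support) (l : List b.support) :
    wordProd b (i :: l) = simpleReflection b i * wordProd b l := by
  simp [wordProd]

@[simp] theorem wordProd_append (l₁ l₂ : List b.support) :
    wordProd b (l₁ ++ l₂) = wordProd b l₁ * wordProd b l₂ := by
  simp [wordProd]

theorem simpleReflection_mul_self (i : b.support) :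
    simpleReflection b i * simpleReflection b i = 1 :=
  ofIdx_mul_self _

variable [CharZero k] [Finite ι] [P.IsCrystallographic] [P.IsReduced]

theorem exists_wordProd_eq (w : P.weylGroup) : ∃ l, wordProd b l = w := by
  have key (r : ι) : ∃ l, wordProd b l = weylGroup.ofIdx P r := by
    have conj (i j : ι) : weylGroup.ofIdx P (P.reflectionPerm j i) =
        weylGroup.ofIdx P j * weylGroup.ofIdx P i * weylGroup.ofIdx P j := by
      rw [conj_ofIdx (weylGroup.ofIdx P j), mul_assoc, ofIdx_mul_self, mul_one, ofIdx_smul_index]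
    induction r using b.induction_reflect with
    | h₀ i h =>
      obtain ⟨l, hl⟩ := h
      exact ⟨l, by rw [conj, ofIdx_mul_self, one_mul, hl]⟩
    | h₁ i hi => exact ⟨[⟨i, hi⟩], by simp [simpleReflection]⟩
    | h₂ i j h hj =>
      obtain ⟨l, hl⟩ := h
      exact ⟨⟨j, hj⟩ :: (l ++ [⟨j, hj⟩]), by simp [conj, hl, simpleReflection, mul_assoc]⟩
  obtain ⟨w, hw⟩ := w
  induction hw using weylGroup.induction with
  | mem r => exact key r
  | one => exact ⟨[], rfl⟩
  | mul w₁ w₂ _ _ h₁ h₂ =>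
    obtain ⟨l₁, h₁⟩ := h₁
    obtain ⟨l₂, h₂⟩ := h₂
    exact ⟨l₁ ++ l₂, by rw [wordProd_append, h₁, h₂]; rfl⟩

theorem exists_reduced_word (w : P.weylGroup) :
    ∃ l : List b.support, l.length = length b w ∧ wordProd b l = w := by
  obtain ⟨l, hl⟩ := exists_wordProd_eq b w
  exact Nat.sInf_mem
    (s := {n : ℕ | ∃ l : List b.support, l.length = n ∧ wordProd b l = w}) ⟨_, l, rfl, hl⟩


omit [CharZero k] [Finite ι] [P.IsCrystallographic] [P.IsReduced] in
theorem length_wordProd_le (l : List b.support) : length b (wordProd b l) ≤ l.length :=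
  Nat.sInf_le ⟨l, rfl, rfl⟩

omit [P.IsCrystallographic] [Finite ι] [P.IsReduced] in
theorem isPos_ofIdx_smul_self_iff (r : ι) : b.IsPos (weylGroup.ofIdx P r • r) ↔ ¬ b.IsPos r :=
  RootPairing.Base.IsPos.neg_iff_not b r

/-- The exchange condition. -/
theorem exchange (l : List b.support) (i : b.support)
    (h : ¬ b.IsPos (wordProd b l • (i : ι))) :
    ∃ l' : List b.support, l'.length + 1 = l.length ∧
      wordProd b l' = wordProd b l * simpleReflection b i := by
  induction l with
  | nil => exact absurd (b.isPos_of_mem_support i.2) (by simpa using h)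
  | cons t l ih =>
    by_cases hl : b.IsPos (wordProd b l • (i : ι))
    -- `s_t` makes no positive root negative except `α_t`, so the suffix sends `α_i` to `α_t`, and
    -- the letter `t` can be deleted.
    · have ht : wordProd b l • (i : ι) = t := by
        by_contra hne
        exact h (by rw [wordProd_cons, mul_smul]; exact hl.reflectionPerm t.2 hne)
      refine ⟨l, rfl, ?_⟩
      have hc : wordProd b l * simpleReflection b i = simpleReflection b t * wordProd b l := by
        rw [simpleReflection, conj_ofIdx, ht, simpleReflection]
      rw [wordProd_cons, mul_assoc, hc, ← mul_assoc, simpleReflection_mul_self, one_mul]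
    · obtain ⟨l', h₁, h₂⟩ := ih hl
      exact ⟨t :: l', by simp [h₁], by rw [wordProd_cons, h₂, wordProd_cons, mul_assoc]⟩

theorem isPos_smul_of_length_mul_simpleReflection {w : P.weylGroup} {i : b.support}
    (h : length b (w * simpleReflection b i) = length b w + 1) : b.IsPos (w • (i : ι)) := by
  by_contra hn
  obtain ⟨l, hl, rfl⟩ := exists_reduced_word b w
  obtain ⟨l', h₁, h₂⟩ := exchange b l i hn
  have := length_wordProd_le b l'
  rw [h₂] at this
  omega

/-- Induction along reduced words. -/
theorem length_induction {p : P.weylGroup → Prop} (one : p 1)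
    (mul : ∀ v i, length b (v * simpleReflection b i) = length b v + 1 → p v →
      p (v * simpleReflection b i)) (w : P.weylGroup) : p w := by
  obtain ⟨l, hl, rfl⟩ := exists_reduced_word b w
  induction l using List.reverseRecOn with
  | nil => exact one
  | append_singleton l i ih =>
    -- Comparison with `l' ++ [i]` shows that the prefix `l` of a reduced word is reduced.
    obtain ⟨l', hl', hw'⟩ := exists_reduced_word b (wordProd b l)
    have h₁ := length_wordProd_le b l
    have h₂ := length_wordProd_le b (l' ++ [i])
    simp only [wordProd_append, wordProd_cons, wordProd_nil, mul_one, hw', List.length_append,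
      List.length_cons, List.length_nil] at h₂ hl ⊢
    exact mul _ _ (by omega) (ih (by omega))

theorem isPos_reflectionPerm_iff {r j : ι} (hj : j ∈ b.support) (h₁ : r ≠ j)
    (h₂ : P.reflectionPerm j r ≠ j) : b.IsPos (P.reflectionPerm j r) ↔ b.IsPos r :=
  ⟨fun h => by simpa using h.reflectionPerm hj h₂, fun h => h.reflectionPerm hj h₁⟩

/-- For roots and coroots alike, negation reverses the sign and `s_j` preserves it away from `±α_j`;
both notions therefore propagate identically from the simple roots. -/
theorem isPos_flip_iff (r : ι) : b.flip.IsPos r ↔ b.IsPos r := by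
  have hneg (t : ι) : b.flip.IsPos (P.reflectionPerm t t) ↔ ¬ b.flip.IsPos t :=
    RootPairing.Base.IsPos.neg_iff_not b.flip t
  have hneg' (t : ι) : b.IsPos (P.reflectionPerm t t) ↔ ¬ b.IsPos t :=
    RootPairing.Base.IsPos.neg_iff_not b t
  induction r using b.induction_reflect with
  | h₀ i h => exact ((hneg _).trans (not_congr h)).trans (hneg' _).symm
  | h₁ i hi =>
    exact iff_of_true (RootPairing.Base.isPos_of_mem_support (b := b.flip) hi)
      (RootPairing.Base.isPos_of_mem_support hi)
  | h₂ r j h hj =>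
    by_cases hr : r = j
    · subst hr
      exact ((hneg _).trans (not_congr h)).trans (hneg' _).symm
    by_cases hr' : P.reflectionPerm j r = j
    · rw [hr']
      exact iff_of_true (RootPairing.Base.isPos_of_mem_support (b := b.flip) hj)
        (RootPairing.Base.isPos_of_mem_support hj)
    · exact ((isPos_reflectionPerm_iff b.flip hj hr hr').trans h).trans
        (isPos_reflectionPerm_iff b hj hr hr').symm

end WeylGroup

/-! ### Simple root coefficients as pairings with fundamental coweights. -/

section Coefficients

variable {ι k M N : Type*} [Field k] [CharZero k] [AddCommGroup M] [Module k M]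
  [AddCommGroup N] [Module k N] {P : RootPairing ι k M N} (b : P.Base)

/-- The coefficient of the simple root `α_i` in the root with index `r`. -/
def coeff (i : b.support) (r : ι) : ℤ :=
  (b.exists_root_eq_sum_int r).choose i

theorem root_eq_sum_coeff (r : ι) : P.root r = ∑ i : b.support, coeff b i r • P.root i := by
  exact (b.exists_root_eq_sum_int r).choose_spec.2.2.trans (Finset.sum_coe_sort b.support
    (fun j => (b.exists_root_eq_sum_int r).choose j • P.root j)).symm

theorem coeff_nonneg_of_isPos {r : ι} (h : b.IsPos r) (i : b.support) : 0 ≤ coeff b i r := by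
  obtain ⟨-, hf | hf, -⟩ := (b.exists_root_eq_sum_int r).choose_spec
  · exact hf.le i
  · exact absurd (Finset.sum_nonpos fun j _ => hf.le j) (not_le.2 h)

theorem coeff_nonpos_of_not_isPos {r : ι} (h : ¬ b.IsPos r) (i : b.support) :
    coeff b i r ≤ 0 := by
  obtain ⟨-, hf | hf, -⟩ := (b.exists_root_eq_sum_int r).choose_spec
  · exact absurd (Finset.sum_nonneg fun j _ => hf.le j) (fun h' => h (b.isPos_iff'.2 h'))
  · exact hf.le i

variable [P.IsRootSystem]

/-- Identifies the chosen integers `coeff` with basis coordinates, hence makes them independent of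
the choice. -/
theorem repr_root (i : b.support) (r : ι) :
    b.toWeightBasis.repr (P.root r) i = (coeff b i r : k) := by
  classical
  rw [root_eq_sum_coeff b r]
  simp [Finsupp.single_apply]

open Classical in
theorem coeff_simple (i j : b.support) : coeff b i j = if i = j then 1 else 0 := by
  have h := repr_root b i j
  rw [b.toWeightBasis_repr_root, Finsupp.single_apply] at h
  split_ifs at h ⊢ with h₁ h₂ h₂
  · exact_mod_cast h.symm
  · exact absurd h₁.symm h₂
  · exact absurd h₂.symm h₁
  · exact_mod_cast h.symm

omit [CharZero k] in
open Classical in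
theorem repr_simpleReflection_smul (i j : b.support) (x : M) :
    b.toWeightBasis.repr (simpleReflection b j • x) i =
      b.toWeightBasis.repr x i -
        if i = j then P.toLinearMap x (P.coroot j) else 0 := by
  rw [simpleReflection, weylGroup.ofIdx_smul, Equiv.reflection_smul, reflection_apply, map_sub,
    map_smul, b.toWeightBasis_repr_root, Finsupp.sub_apply, Finsupp.smul_apply,
    Finsupp.single_apply]
  split_ifs with h₁ h₂ h₂
  · simp
  · exact absurd h₁.symm h₂
  · exact absurd h₂.symm h₁
  · simp

variable [P.IsCrystallographic]

omit [P.IsRootSystem] in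
theorem coroot_pairing_eq_sum (i : b.support) (r : ι) :
    P.pairingIn ℤ r i = ∑ j, cartan b i j * coeff b j r := by
  have h : P.toLinearMap (P.root r) (P.coroot i) =
      ((∑ j, cartan b i j * coeff b j r : ℤ) : k) := by
    rw [root_eq_sum_coeff b r, map_sum, LinearMap.sum_apply, Int.cast_sum]
    refine Finset.sum_congr rfl fun j _ => ?_
    rw [map_zsmul, LinearMap.smul_apply, root_coroot_eq_pairing, ← P.algebraMap_pairingIn ℤ,
      cartan]
    simp [mul_comm]
  rw [root_coroot_eq_pairing, ← P.algebraMap_pairingIn ℤ] at h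
  exact Int.cast_injective (α := k) h

open Classical in
/-- The coweight identity `s_i(ω_i^∨) + ω_i^∨ = - ∑_{j ≠ i} C_{i,j} ω_j^∨`, evaluated at a root. -/
theorem coeff_simpleReflection_smul_add (i : b.support) (r : ι) :
    coeff b i (simpleReflection b i • r) + coeff b i r =
      ∑ j ∈ Finset.univ.filter (fun j : b.support => j ≠ i), -cartan b i j * coeff b j r := by
  have h : (coeff b i (simpleReflection b i • r) : k) =
      ((coeff b i r - P.pairingIn ℤ r i : ℤ) : k) := by
    rw [← repr_root, root_weylGroup_smul, repr_simpleReflection_smul, if_pos rfl, repr_root,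
      root_coroot_eq_pairing, ← P.algebraMap_pairingIn ℤ]
    simp
  have h' := Int.cast_injective h
  -- The diagonal term of the pairing cancels the two copies of `coeff b i r`.
  have hc : cartan b i i = 2 := by simp [cartan]
  rw [h', coroot_pairing_eq_sum, ← Finset.sum_filter_add_sum_filter_not _ (fun j => j ≠ i)]
  have : Finset.univ.filter (fun j : b.support => ¬ j ≠ i) = {i} := by ext; simp
  rw [this, Finset.sum_singleton, hc]
  simp only [neg_mul, Finset.sum_neg_distrib]
  ring

end Coefficients

/-! ### Dominance of fundamental weights and their stabilizers. -/

section WeightStabilizer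

variable {ι k M N : Type*} [Field k] [AddCommGroup M] [Module k M]
  [AddCommGroup N] [Module k N] {P : RootPairing ι k M N} (b : P.Base) [P.IsRootSystem]

theorem simpleReflection_smul_fundamentalWeight_of_ne {i j : b.support} (h : i ≠ j) :
    simpleReflection b j • fundamentalWeight b i = fundamentalWeight b i := by
  rw [simpleReflection, weylGroup.ofIdx_smul, Equiv.reflection_smul, reflection_apply]
  have : P.coroot' j (fundamentalWeight b i) = 0 :=
    (fundamentalWeight_coroot b i j).trans (if_neg h)
  rw [this, zero_smul, sub_zero]

variable [CharZero k] [Finite ι] [P.IsCrystallographic] [P.IsReduced]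

theorem fundamentalWeight_coroot_nonneg (i : b.support) {r : ι} (h : b.IsPos r) :
    ∃ n : ℕ, P.toLinearMap (fundamentalWeight b i) (P.coroot r) = n := by
  classical
  have hr : P.coroot r = ∑ j : b.support, coeff b.flip j r • P.coroot j :=
    root_eq_sum_coeff b.flip r
  refine ⟨(coeff b.flip i r).toNat, ?_⟩
  have hn := coeff_nonneg_of_isPos b.flip ((isPos_flip_iff b r).2 h) i
  have hz : P.toLinearMap (fundamentalWeight b i) (P.coroot r) = (coeff b.flip i r : k) := by
    rw [hr, map_sum, Finset.sum_eq_single i]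
    · rw [map_zsmul, fundamentalWeight_coroot, if_pos rfl]
      simp
    · intro j _ hj
      rw [map_zsmul, fundamentalWeight_coroot, if_neg hj.symm, smul_zero]
    · simp
  rw [hz]
  exact_mod_cast (congrArg (Int.cast : ℤ → k) (Int.toNat_of_nonneg hn)).symm

/-- Weyl group elements carrying `ω_i` to `ω_j` carry `ω_i^∨` to `ω_j^∨`. -/
theorem repr_inv_smul_of_smul_fundamentalWeight_eq (v : P.weylGroup) (i j : b.support)
    (h : v • fundamentalWeight b i = fundamentalWeight b j) (x : M) :
    b.toWeightBasis.repr (v⁻¹ • x) i = b.toWeightBasis.repr x j := by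
  induction v using length_induction b generalizing x with
  | one =>
    have hij : i = j := by
      by_contra hij
      have h₁ := fundamentalWeight_coroot b i j
      rw [one_smul] at h
      rw [h, fundamentalWeight_coroot, if_pos rfl, if_neg hij] at h₁
      exact one_ne_zero h₁
    rw [hij, inv_one, one_smul]
  | mul v t hv ih =>
    have hpos := isPos_smul_of_length_mul_simpleReflection b hv
    obtain ⟨n, hn⟩ := fundamentalWeight_coroot_nonneg b j hpos
    -- If `i = t`, pairing `ω_j = v s_i(ω_i)` with the coroot of `vα_i > 0` gives `-1`, against
    -- dominance of `ω_j`. So `s_t` fixes both `ω_i` and `ω_i^∨`.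
    have hti : i ≠ t := by
      rintro rfl
      rw [← h, mul_smul, smul_coroot_invariant, simpleReflection, weylGroup.ofIdx_smul,
        Equiv.reflection_smul, reflection_apply, map_sub, LinearMap.sub_apply, map_smul,
        LinearMap.smul_apply, root_coroot_two] at hn
      have h₁ : P.coroot' i (fundamentalWeight b i) = 1 :=
        (fundamentalWeight_coroot b i i).trans (if_pos rfl)
      have h₂ : P.toLinearMap (fundamentalWeight b i) (P.coroot i) = 1 := h₁
      rw [h₁, h₂, smul_eq_mul] at hn
      have h₃ : ((n + 1 : ℕ) : k) = 0 := by
        push_cast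
        rw [← hn]
        ring
      exact absurd h₃ (Nat.cast_ne_zero.2 n.succ_ne_zero)
    rw [mul_smul, simpleReflection_smul_fundamentalWeight_of_ne b hti] at h
    rw [mul_inv_rev, mul_smul, simpleReflection, ofIdx_inv, ← simpleReflection,
      repr_simpleReflection_smul, if_neg hti, sub_zero, ih h]

end WeightStabilizer

/-! ### The explicit product: well-definedness, relations, uniqueness. -/

section Solution

variable {ι k M N : Type*} [Field k] [CharZero k] [AddCommGroup M] [Module k M]
  [AddCommGroup N] [Module k N] {P : RootPairing ι k M N} (b : P.Base)

/-- The exponent `max(0, -⟨β, w(ω_i^∨)⟩)`, where `β` is the root with index `r`. -/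
def negCoeff (w : P.weylGroup) (i : b.support) (r : ι) : ℕ :=
  (-coeff b i (w⁻¹ • r)).toNat

variable [P.IsRootSystem] [P.IsCrystallographic]

theorem one_sub_bracket_ne_zero (r : ι) : 1 - bracket b (-rootWeight b r) ≠ 0 := by
  intro h
  have h₁ : algebraMap (WeightRing b) (WeightField b) 1 =
      algebraMap (WeightRing b) (WeightField b) (AddMonoidAlgebra.single (-rootWeight b r) 1) := by
    rw [map_one]
    exact sub_eq_zero.1 h
  have h₂ := IsFractionRing.injective (WeightRing b) (WeightField b) h₁
  have h₃ := AddMonoidAlgebra.single_left_injective (one_ne_zero (α := ℤ)) h₂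
  exact P.ne_zero r (congrArg Subtype.val (neg_eq_zero.1 h₃.symm))

/-- The generator `(1 - [-β])⁻¹`, where `β` is the root with index `r`. -/
def invFactor (r : ι) : WeightField b :=
  (1 - bracket b (-rootWeight b r))⁻¹

theorem invFactor_ne_zero (r : ι) : invFactor b r ≠ 0 :=
  inv_ne_zero (one_sub_bracket_ne_zero b r)

omit [CharZero k] in
theorem smul_alpha (w : P.weylGroup) (i : b.support) :
    w • alpha b i = rootWeight b (w • (i : ι)) :=
  Subtype.ext (root_weylGroup_smul w i).symm

open Classical in
/-- The explicit solution `∏_{β > 0} (1 - [-β])^{-max(0, -⟨β, w(ω_i^∨)⟩)}`. -/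
def chiValue [Fintype ι] (w : P.weylGroup) (i : b.support) : WeightField b :=
  ∏ r with b.IsPos r, invFactor b r ^ negCoeff b w i r

theorem chiValue_mem [Fintype ι] (w : P.weylGroup) (i : b.support) :
    chiValue b w i ∈ chiRing b :=
  Subring.prod_mem _ fun r _ => Subring.pow_mem _ (Subring.subset_closure (Set.mem_range_self r)) _

theorem chiValue_ne_zero [Fintype ι] (w : P.weylGroup) (i : b.support) : chiValue b w i ≠ 0 :=
  Finset.prod_ne_zero_iff.2 fun r _ => pow_ne_zero _ (invFactor_ne_zero b r)

theorem chiValue_one [Fintype ι] (i : b.support) : chiValue b 1 i = 1 := by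
  classical
  refine Finset.prod_eq_one fun r hr => ?_
  have := coeff_nonneg_of_isPos b (Finset.mem_filter.1 hr).2 i
  rw [negCoeff, inv_one, one_smul, Int.toNat_of_nonpos (by omega), pow_zero]

variable [P.IsReduced]

theorem chiValue_eq_of_smul_omega_eq [Fintype ι] {w w' : P.weylGroup} {i j : b.support}
    (h : w • omega b i = w' • omega b j) : chiValue b w i = chiValue b w' j := by
  have hv : (w'⁻¹ * w) • fundamentalWeight b i = fundamentalWeight b j := by
    rw [mul_smul, inv_smul_eq_iff]
    exact congrArg Subtype.val h
  refine Finset.prod_congr rfl fun r _ => ?_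
  have hc : coeff b i (w⁻¹ • r) = coeff b j (w'⁻¹ • r) := by
    have := repr_inv_smul_of_smul_fundamentalWeight_eq b _ i j hv (w'⁻¹ • P.root r)
    rw [← mul_smul, mul_inv_rev, inv_inv, mul_inv_cancel_right, ← root_weylGroup_smul,
      ← root_weylGroup_smul, repr_root, repr_root] at this
    exact Int.cast_injective this
  rw [negCoeff, negCoeff, hc]

open Classical in
/-- Off the simple root `α_i`, the truncated coweight identity holds because all coefficients of a
root have the same sign. -/
theorem negCoeff_mul_simpleReflection_add [Finite ι]
    {w : P.weylGroup} {i : b.support} (hw : b.IsPos (w • (i : ι))) {r : ι} (hr : b.IsPos r) :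
    (negCoeff b (w * simpleReflection b i) i r : ℤ) + negCoeff b w i r =
      (if r = w • (i : ι) then 1 else 0) +
        ∑ j ∈ Finset.univ.filter (fun j : b.support => j ≠ i),
          -cartan b i j * negCoeff b w j r := by
  have hs : (w * simpleReflection b i)⁻¹ • r = simpleReflection b i • (w⁻¹ • r) := by
    rw [mul_inv_rev, mul_smul, simpleReflection, ofIdx_inv]
  have hwr : r = w • (w⁻¹ • r) := (smul_inv_smul w r).symm
  have hid := coeff_simpleReflection_smul_add b i (w⁻¹ • r)
  simp only [negCoeff, hs]
  generalize w⁻¹ • r = t at hwr hid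
  subst hwr
  by_cases ht : t = i
  · subst ht
    have hz (j : b.support) (hj : j ∈ Finset.univ.filter (fun j : b.support => j ≠ i)) :
        coeff b j i = 0 := by
      rw [coeff_simple, if_neg (Finset.mem_filter.1 hj).2]
    have hi : coeff b i i = 1 := by rw [coeff_simple, if_pos rfl]
    rw [Finset.sum_eq_zero fun j hj => by rw [hz j hj, mul_zero], hi] at hid
    rw [if_pos rfl, Finset.sum_eq_zero fun j hj => by rw [hz j hj]; simp, hi]
    have h₁ : coeff b i (simpleReflection b i • (i : ι)) = -1 := by omega
    rw [h₁]
    rfl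
  -- Excludes `t = -α_i`, for which `r` would be the negative root `-wα_i`.
  · have hst : simpleReflection b i • t ≠ (i : ι) := by
      intro h
      have h₁ : t = simpleReflection b i • (i : ι) := by
        rw [← h, ← mul_smul, simpleReflection_mul_self, one_smul]
      rw [h₁, simpleReflection, ← mul_smul, conj_ofIdx, mul_smul,
        isPos_ofIdx_smul_self_iff] at hr
      exact hr hw
    have hsign := isPos_reflectionPerm_iff b i.2 ht hst
    change b.IsPos (simpleReflection b i • t) ↔ b.IsPos t at hsign
    rw [if_neg (fun h => ht (MulAction.injective w h)), zero_add]
    -- For `t > 0` every truncated term vanishes; for `t < 0` truncation is plain negation and `hid`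
    -- applies.
    by_cases hpos : b.IsPos t
    · have hnat {t : ι} (ht : b.IsPos t) (j : b.support) : (-coeff b j t).toNat = 0 :=
        Int.toNat_of_nonpos (neg_nonpos.2 (coeff_nonneg_of_isPos b ht j))
      rw [hnat (hsign.2 hpos), Finset.sum_eq_zero fun j _ => by rw [hnat hpos]; simp, hnat hpos]
      rfl
    · have hnat {t : ι} (ht : ¬ b.IsPos t) (j : b.support) :
          ((-coeff b j t).toNat : ℤ) = -coeff b j t :=
        Int.toNat_of_nonneg (neg_nonneg.2 (coeff_nonpos_of_not_isPos b ht j))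
      rw [hnat (fun h => hpos (hsign.1 h)), hnat hpos,
        Finset.sum_congr rfl fun j _ => by rw [hnat hpos]]
      simp only [mul_neg, Finset.sum_neg_distrib, ← hid]
      ring

open Classical in
theorem chiValue_mul_chiValue [Fintype ι]
    {w : P.weylGroup} {i : b.support} (hw : b.IsPos (w • (i : ι))) :
    chiValue b (w * simpleReflection b i) i * chiValue b w i =
      (1 - bracket b (-(w • alpha b i)))⁻¹ *
        ∏ j ∈ Finset.univ.filter (fun j : b.support => j ≠ i),
          chiValue b w j ^ (-cartan b i j) := by
  have hfac : (1 - bracket b (-(w • alpha b i)))⁻¹ =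
      ∏ r with b.IsPos r, invFactor b r ^ (if r = w • (i : ι) then 1 else 0 : ℤ) := by
    rw [Finset.prod_eq_single (w • (i : ι)), if_pos rfl, zpow_one, smul_alpha, invFactor]
    · intro r _ hr
      rw [if_neg hr, zpow_zero]
    · intro h
      exact absurd (Finset.mem_filter.2 ⟨Finset.mem_univ _, hw⟩) h
  have hpow (j : b.support) : chiValue b w j ^ (-cartan b i j) =
      ∏ r with b.IsPos r, invFactor b r ^ (-cartan b i j * negCoeff b w j r) := by
    rw [chiValue, ← Finset.prod_zpow]
    refine Finset.prod_congr rfl fun r _ => ?_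
    rw [← zpow_natCast, ← zpow_mul, mul_comm]
  simp only [hfac, hpow]
  rw [Finset.prod_comm, chiValue, chiValue, ← Finset.prod_mul_distrib, ← Finset.prod_mul_distrib]
  refine Finset.prod_congr rfl fun r hr => ?_
  have hsum (s : Finset b.support) (f : b.support → ℤ) :
      ∏ j ∈ s, invFactor b r ^ f j = invFactor b r ^ ∑ j ∈ s, f j := by
    induction s using Finset.induction_on with
    | empty => simp
    | insert a s ha ih =>
      rw [Finset.prod_insert ha, Finset.sum_insert ha, ih, zpow_add₀ (invFactor_ne_zero b r)]
  rw [hsum, ← zpow_add₀ (invFactor_ne_zero b r), ← zpow_natCast, ← zpow_natCast,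
    ← zpow_add₀ (invFactor_ne_zero b r),
    negCoeff_mul_simpleReflection_add b hw (Finset.mem_filter.1 hr).2]

open Classical in
/-- The system of relations satisfied by the family `χ`. -/
def IsChiSystem (χ : extremalWeights b → chiRing b) : Prop :=
  (∀ i : b.support, χ (extremal b 1 i) = 1) ∧
    ∀ (w : P.weylGroup) (i : b.support),
      length b (w * simpleReflection b i) = length b w + 1 →
      (χ (extremal b (w * simpleReflection b i) i) : WeightField b) *
          (χ (extremal b w i) : WeightField b) =
        (1 - bracket b (-(w • alpha b i)))⁻¹ *
          ∏ j ∈ Finset.univ.filter (fun j : b.support => j ≠ i),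
            (χ (extremal b w j) : WeightField b) ^ (-cartan b i j)

theorem isChiSystem_apply_eq [Fintype ι] {χ : extremalWeights b → chiRing b}
    (hχ : IsChiSystem b χ) (w : P.weylGroup) (i : b.support) :
    (χ (extremal b w i) : WeightField b) = chiValue b w i := by
  induction w using length_induction b generalizing i with
  | one => rw [hχ.1, chiValue_one, OneMemClass.coe_one]
  | mul v t hv ih =>
    by_cases hti : i = t
    · subst hti
      apply mul_right_cancel₀ (chiValue_ne_zero b v i)
      rw [chiValue_mul_chiValue b (isPos_smul_of_length_mul_simpleReflection b hv), ← ih i,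
        hχ.2 v i hv]
      simp only [ih]
    -- For `i ≠ t` the weight is unchanged, so no relation is needed.
    · have h : (v * simpleReflection b t) • omega b i = v • omega b i := by
        rw [mul_smul]
        exact congrArg (v • ·)
          (Subtype.ext (simpleReflection_smul_fundamentalWeight_of_ne b hti))
      have h' : extremal b (v * simpleReflection b t) i = extremal b v i := Subtype.ext h
      rw [h', ih, chiValue_eq_of_smul_omega_eq b h]

theorem existsUnique_isChiSystem [Finite ι] : ∃! χ, IsChiSystem b χ := by
  have := Fintype.ofFinite ι
  -- An arbitrary presentation of each weight as `w(ω_i)`; `hval` makes the choice harmless.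
  choose w i h using fun x : extremalWeights b => x.2
  have hval (v : P.weylGroup) (j : b.support) :
      chiValue b (w (extremal b v j)) (i (extremal b v j)) = chiValue b v j :=
    chiValue_eq_of_smul_omega_eq b (h (extremal b v j)).symm
  refine ⟨fun x => ⟨chiValue b (w x) (i x), chiValue_mem b _ _⟩, ⟨fun j => ?_, ?_⟩, ?_⟩
  · exact Subtype.ext ((hval 1 j).trans (chiValue_one b j))
  · intro v j hv
    simp only [hval]
    exact chiValue_mul_chiValue b (isPos_smul_of_length_mul_simpleReflection b hv)
  · intro χ hχ
    funext x
    apply Subtype.ext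
    have hx : x = extremal b (w x) (i x) := Subtype.ext (h x)
    exact (congrArg (fun y => (χ y : WeightField b)) hx).trans (isChiSystem_apply_eq b hχ _ _)

end Solution

end ExtQQ

end

open Classical in
theorem lemma5p2 {𝔤 : Type*} [LieRing 𝔤] [LieAlgebra ℂ 𝔤] [FiniteDimensional ℂ 𝔤]
    [LieAlgebra.IsSimple ℂ 𝔤] (H : LieSubalgebra ℂ 𝔤) [H.IsCartanSubalgebra]
    (b : (LieAlgebra.IsKilling.rootSystem H).Base) :
    ∃! χ : ExtQQ.extremalWeights b → ExtQQ.chiRing b,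
      (∀ i : b.support, χ (ExtQQ.extremal b 1 i) = 1) ∧
      ∀ (w : (LieAlgebra.IsKilling.rootSystem H).weylGroup) (i : b.support),
        ExtQQ.length b (w * ExtQQ.simpleReflection b i) = ExtQQ.length b w + 1 →
        (χ (ExtQQ.extremal b (w * ExtQQ.simpleReflection b i) i) : ExtQQ.WeightField b) *
            (χ (ExtQQ.extremal b w i) : ExtQQ.WeightField b) =
          (1 - ExtQQ.bracket b (-(w • ExtQQ.alpha b i)))⁻¹ *
            ∏ j ∈ Finset.univ.filter (fun j : b.support => j ≠ i),
              (χ (ExtQQ.extremal b w j) : ExtQQ.WeightField b) ^ (-ExtQQ.cartan b i j) := by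
  have h := ExtQQ.existsUnique_isChiSystem b
  unfold ExtQQ.IsChiSystem at h
  convert h
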